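/- Let $\Lambda$ be a countable finitely aligned category of paths, i.e. a countable small category (with range and source maps $r,s$ and vertex set $\Lambda^0$) in which $\alpha\beta=\alpha\gamma$ implies $\beta=\gamma$, $\beta\alpha=\gamma\alpha$ implies $\beta=\gamma$, and $\alpha\beta=s(\beta)$ implies $\alpha=\beta=s(\beta)$, and such that for all $\alpha,\beta\in\Lambda$ the set $\alpha\Lambda\cap\beta\Lambda$ is a finite union of sets $\varepsilon\Lambda$, $\varepsilon\in\Lambda$. For $v\in\Lambda^0$ let $v\Lambda$ be the set of paths with range $v$. A zigzag is a tuple $\zeta=(\alpha_1,\beta_1,\dots,\alpha_n,\beta_n)$, $n\ge 1$, of elements of $\Lambda$ with $r(\alpha_i)=r(\beta_i)$ and $s(\alpha_{i+1})=s(\beta_i)$; it defines the partial map $\sigma^{\alpha_1}\beta_1\cdots\sigma^{\alpha_n}\beta_n$ from $s(\beta_n)\Lambda$ to $s(\alpha_1)\Lambda$, where $\sigma^\alpha(\alpha\gamma)=\gamma$. Let $\mathcal A_v$ be the ring of subsets of $v\Lambda$ generated by the domains of the zigzag maps with $s(\beta_n)=v$, let $X_v$ be the space of ultrafilters in $\mathcal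 A_v$ with the topology generated by the sets $\{\mathcal U\in X_v: E\in\mathcal U\}$, $E\in\mathcal A_v$, and let $X=\bigsqcup_{v\in\Lambda^0}X_v$. For $\alpha\in\Lambda$ and $x\in X_{s(\alpha)}$ let $\alpha x\in X_{r(\alpha)}$ be the ultrafilter with base $\{\alpha E:E\in x\}$. The groupoid $G$ of $\Lambda$ consists of the classes $[\alpha,\beta,x]$ of triples with $s(\alpha)=s(\beta)=v$ and $x\in X_v$ for some $v\in\Lambda^0$, where $(\alpha,\beta,x)\sim(\alpha',\beta',x')$ if there are $w\in\Lambda^0$, $z\in X_w$ and $\delta,\delta'\in\Lambda$ with source $w$ such that $x=\delta z$, $x'=\delta' z$, $\alpha\delta=\alpha'\delta'$ and $\beta\delta=\beta'\delta'$; the unit space of $G$ is identified with $X$, the element $[\alpha,\beta,x]$ has range $\alpha x$, source $\beta x$ and inverse $[\beta,\alpha,x]$, and $[\alpha,\beta,x][\gamma,\delta,y]=[\alpha\xi,\delta\eta,z]$ whenever $x=\xi z$, $y=\eta z$ and $\beta\xi=\gamma\eta$. A set $C\subseteq v\Lambda$ is directed if $\alpha\Lambda\cap\beta\Lambda\cap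 C\ne\emptyset$ for all $\alpha,\beta\in C$. Each maximal directed set $C\subseteq v\Lambda$ defines the point $\{E\in\mathcal A_v: E\supseteq C\cap\alpha\Lambda\text{ for some }\alpha\in C\}$ of $X_v$, and the boundary $\partial\Lambda$ is the closure in $X$ of the set of all these points, $v\in\Lambda^0$. Let $G|_{\partial\Lambda}$ be the groupoid of all $g\in G$ with $r(g),s(g)\in\partial\Lambda$; it is minimal if for each $x\in\partial\Lambda$ the orbit $\{r(g):g\in G|_{\partial\Lambda},\ s(g)=x\}$ is dense in $\partial\Lambda$. A set $F\subseteq v\Lambda$ is exhaustive at $v$ if for every $\alpha\in v\Lambda$ there is $\beta\in F$ with $\alpha\Lambda\cap\beta\Lambda\neq\emptyset$. Then $G|_{\partial\Lambda}$ is minimal if and only if for every pair $u,v\in\Lambda^0$ there exists a finite exhaustive set $F$ at $v$ such that for each $\alpha\in F$ the set $u\Lambda s(\alpha)$ of paths with range $u$ and source $s(\alpha)$ is nonempty. -/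

import Mathlib

open CategoryTheory

universe u v

namespace PathCat

/-! ### Categories of paths

A path `α` with range `r(α)` and source `s(α)` is a morphism `α : s(α) ⟶ r(α)`, and the product
`αβ` (defined when `s(α) = r(β)`) is `β ≫ α`. -/

/-- A category of paths: a category with left and right cancellation and no inverses. -/
class CategoryOfPaths (Λ : Type u) [Category.{v} Λ] : Prop where
  /-- `αβ = αγ` implies `β = γ`. -/
  left_cancel : ∀ {a b c : Λ} (α : b ⟶ c) (β γ : a ⟶ b), β ≫ α = γ ≫ α → β = γ
  /-- `βα = γα` implies `β = γ`. -/
  right_cancel : ∀ {a b c : Λ} (α : a ⟶ b) (β γ : b ⟶ c), α ≫ β = α ≫ γ → β = γ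
  /-- `αβ = s(β)` implies `α = β = s(β)`. -/
  no_inverses : ∀ {a b : Λ} (α : b ⟶ a) (β : a ⟶ b), β ≫ α = 𝟙 a →
    ∃ h : a = b, β = eqToHom h ∧ α = eqToHom h.symm

variable {Λ : Type u} [Category.{v} Λ]

/-- The set `vΛ` of paths with range `v`; `γ.1` is the source of `γ : PathsTo v`. -/
abbrev PathsTo (v : Λ) : Type (max u v) := Σ w : Λ, (w ⟶ v)

/-- The map `β ↦ αβ` from `s(α)Λ` to `r(α)Λ`. -/
def concat {w v : Λ} (α : w ⟶ v) (β : PathsTo w) : PathsTo v := ⟨β.1, β.2 ≫ α⟩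

/-- The tail set `αΛ`. -/
def tail {v : Λ} (α : PathsTo v) : Set (PathsTo v) := Set.range (concat α.2)

/-- `α ⋒ β`: the paths `α` and `β` have a common extension. -/
def Meets {v : Λ} (α β : PathsTo v) : Prop := (tail α ∩ tail β).Nonempty

/-- `F ⊆ vΛ` is exhaustive at `v` if every path in `vΛ` meets some element of `F`. -/
def IsExhaustive {v : Λ} (F : Set (PathsTo v)) : Prop := ∀ α : PathsTo v, ∃ β ∈ F, Meets α β

/-- `FE(v)`: the finite exhaustive sets at `v`. -/
def FE (v : Λ) : Set (Set (PathsTo v)) := {F | F.Finite ∧ IsExhaustive F}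

variable (Λ) in
/-- Finite alignment: `αΛ ∩ βΛ` is a finite union of tail sets, for all paths `α`, `β`
(for paths with different ranges the intersection is empty, so these need not be mentioned). -/
class FinitelyAligned : Prop where
  exists_finite : ∀ {v : Λ} (α β : PathsTo v),
    ∃ G : Set (PathsTo v), G.Finite ∧ tail α ∩ tail β = ⋃ ε ∈ G, tail ε

/-! ### Zigzags and the rings `𝒜_v` -/

/-- `Zigzag w v` is the type of zigzags `(α₁, β₁, …, αₙ, βₙ)`, `n ≥ 1`, with range
`s(α₁) = w` and source `s(βₙ) = v`, where `r(αᵢ) = r(βᵢ)` and `s(αᵢ₊₁) = s(βᵢ)`. -/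
inductive Zigzag : Λ → Λ → Type (max u v)
  | single {w v x : Λ} (α : w ⟶ x) (β : v ⟶ x) : Zigzag w v
  | snoc {w t v x : Λ} (ζ : Zigzag w t) (α : t ⟶ x) (β : v ⟶ x) : Zigzag w v

/-- The graph of the zigzag map `φ_ζ = σ^{α₁} β₁ ⋯ σ^{αₙ} βₙ`, a partial map from `s(ζ)Λ` to
`r(ζ)Λ`: here `δ = σ^α(βγ)` means that `αδ = βγ`. -/
def Zigzag.Graph : {w v : Λ} → Zigzag w v → PathsTo v → PathsTo w → Prop
  | _, _, .single α β, γ, δ => concat α δ = concat β γ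
  | _, _, .snoc ζ α β, γ, δ => ∃ ε, concat α ε = concat β γ ∧ ζ.Graph ε δ

theorem Zigzag.graph_single {w v x : Λ} (α : w ⟶ x) (β : v ⟶ x) (γ : PathsTo v) (δ : PathsTo w) :
    (Zigzag.single α β).Graph γ δ ↔ concat α δ = concat β γ := by
  simp only [Zigzag.Graph]

theorem Zigzag.graph_snoc {w t v x : Λ} (ζ : Zigzag w t) (α : t ⟶ x) (β : v ⟶ x)
    (γ : PathsTo v) (δ : PathsTo w) :
    (Zigzag.snoc ζ α β).Graph γ δ ↔ ∃ ε, concat α ε = concat β γ ∧ ζ.Graph ε δ := by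
  simp only [Zigzag.Graph]

/-- The zigzag set `A(ζ)`, the domain of `φ_ζ`. -/
def Zigzag.domain {w v : Λ} (ζ : Zigzag w v) : Set (PathsTo v) := {γ | ∃ δ, ζ.Graph γ δ}

/-- The ring of sets generated by a collection of sets. -/
def generatedRing {S : Type*} (D : Set (Set S)) : Set (Set S) :=
  {E | ∀ R : Set (Set S), MeasureTheory.IsSetRing R → D ⊆ R → E ∈ R}

/-- The ring `𝒜_v` of subsets of `vΛ` generated by the (nonempty) zigzag sets `A(ζ)` with
`s(ζ) = v`. -/
def ring (v : Λ) : Set (Set (PathsTo v)) :=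
  generatedRing {E | E.Nonempty ∧ ∃ (w : Λ) (ζ : Zigzag w v), E = ζ.domain}

/-! ### Ultrafilters in a ring of sets -/

/-- `𝒰` is a filter in the ring of sets `A`. -/
structure IsFilterIn {S : Type*} (A 𝒰 : Set (Set S)) : Prop where
  subset : 𝒰 ⊆ A
  nonempty : 𝒰.Nonempty
  nonempty_of_mem : ∀ E ∈ 𝒰, E.Nonempty
  inter_mem : ∀ E ∈ 𝒰, ∀ F ∈ 𝒰, E ∩ F ∈ 𝒰
  superset_mem : ∀ E ∈ 𝒰, ∀ F ∈ A, E ⊆ F → F ∈ 𝒰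

/-- An ultrafilter in a ring of sets is a maximal filter. -/
def IsUltrafilterIn {S : Type*} (A 𝒰 : Set (Set S)) : Prop := Maximal (IsFilterIn A) 𝒰

/-- The space `X_v` of ultrafilters in `𝒜_v`. -/
def X (v : Λ) : Type (max u v) := {𝒰 : Set (Set (PathsTo v)) // IsUltrafilterIn (ring v) 𝒰}

/-- The topology of `X_v`, generated by the sets `Ê = {x | E ∈ 𝒰_x}` for `E ∈ 𝒜_v`. -/
instance (v : Λ) : TopologicalSpace (X v) :=
  TopologicalSpace.generateFrom {U | ∃ E ∈ ring v, U = {x : X v | E ∈ x.1}}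

section ultrafilter_facts

variable {S : Type*}

theorem isSetRing_generatedRing (D : Set (Set S)) :
    MeasureTheory.IsSetRing (generatedRing D) where
  empty_mem := fun _ hR _ => hR.empty_mem
  union_mem := fun _ _ hs ht R hR hD => hR.union_mem (hs R hR hD) (ht R hR hD)
  sdiff_mem := fun _ _ hs ht R hR hD => hR.sdiff_mem (hs R hR hD) (ht R hR hD)

theorem subset_generatedRing (D : Set (Set S)) : D ⊆ generatedRing D :=
  fun _ hE _ _ hD => hD hE

theorem isUltrafilterIn_iff {A 𝒰 : Set (Set S)} (hA : MeasureTheory.IsSetRing A) :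
    IsUltrafilterIn A 𝒰 ↔
      IsFilterIn A 𝒰 ∧ ∀ E ∈ A, E ∈ 𝒰 ∨ ∃ F ∈ 𝒰, E ∩ F = ∅ := by
  constructor
  · rintro ⟨hf, hmax⟩
    refine ⟨hf, fun E hE => ?_⟩
    by_contra hcon
    push Not at hcon
    obtain ⟨hE1, hE2⟩ := hcon
    obtain ⟨G, hG⟩ := hf.nonempty
    have h𝒱 : IsFilterIn A {H | H ∈ A ∧ ∃ F ∈ 𝒰, E ∩ F ⊆ H} := by
      refine ⟨fun _ h => h.1, ⟨E, hE, G, hG, Set.inter_subset_left⟩, ?_, ?_, ?_⟩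
      · rintro H ⟨-, F, hF, hH⟩
        exact (hE2 F hF).mono hH
      · rintro H ⟨hHA, F, hF, hH⟩ H' ⟨hHA', F', hF', hH'⟩
        exact ⟨hA.inter_mem hHA hHA', F ∩ F', hf.inter_mem _ hF _ hF',
          fun t ht => ⟨hH ⟨ht.1, ht.2.1⟩, hH' ⟨ht.1, ht.2.2⟩⟩⟩
      · rintro H ⟨-, F, hF, hH⟩ H' hHA' hHH'
        exact ⟨hHA', F, hF, hH.trans hHH'⟩
    have := hmax h𝒱 (fun F hF => ⟨hf.subset hF, F, hF, Set.inter_subset_right⟩)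
    exact hE1 (this ⟨hE, G, hG, Set.inter_subset_left⟩)
  · rintro ⟨hf, h⟩
    refine ⟨hf, fun 𝒱 h𝒱 hle E hE => ?_⟩
    rcases h E (h𝒱.subset hE) with h1 | ⟨F, hF, hEF⟩
    · exact h1
    · have := h𝒱.nonempty_of_mem _ (h𝒱.inter_mem _ hE _ (hle hF))
      simp [hEF] at this

/-- Two ultrafilters of which one contains the other are equal. -/
theorem IsUltrafilterIn.eq_of_subset {A 𝒰 𝒱 : Set (Set S)} (h : IsUltrafilterIn A 𝒰)
    (h' : IsUltrafilterIn A 𝒱) (hle : 𝒰 ⊆ 𝒱) : 𝒰 = 𝒱 :=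
  Set.Subset.antisymm hle (h.2 h'.1 hle)

/-- A finite union that belongs to an ultrafilter has a member in it. -/
theorem IsUltrafilterIn.exists_mem_of_biUnion {A 𝒰 : Set (Set S)}
    (hA : MeasureTheory.IsSetRing A) (h : IsUltrafilterIn A 𝒰) {ι : Type*} {G : Set ι}
    (hG : G.Finite) (f : ι → Set S) (hf : ∀ i ∈ G, f i ∈ A) (hU : (⋃ i ∈ G, f i) ∈ 𝒰) :
    ∃ i ∈ G, f i ∈ 𝒰 := by
  induction G, hG using Set.Finite.induction_on with
  | empty =>
    have := h.1.nonempty_of_mem _ hU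
    simp at this
  | @insert a s ha hs ih =>
    rcases ((isUltrafilterIn_iff hA).1 h).2 (f a) (hf a (Set.mem_insert _ _)) with h1 | ⟨F, hF, hE⟩
    · exact ⟨a, Set.mem_insert _ _, h1⟩
    · have hAs : (⋃ i ∈ s, f i) ∈ A := by
        have := hA.biUnion_mem hs.toFinset (s := f)
          (fun i hi => hf i (Set.mem_insert_of_mem _ (hs.mem_toFinset.1 hi)))
        simpa using this
      have : (⋃ i ∈ s, f i) ∈ 𝒰 := by
        refine h.1.superset_mem _ (h.1.inter_mem _ hU _ hF) _ hAs ?_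
        rintro t ⟨ht, htF⟩
        rw [Set.biUnion_insert] at ht
        rcases ht with ht | ht
        · exact absurd (show t ∈ f a ∩ F from ⟨ht, htF⟩) (by simp [hE])
        · exact ht
      obtain ⟨i, hi, h'⟩ := ih (fun i hi => hf i (Set.mem_insert_of_mem _ hi)) this
      exact ⟨i, Set.mem_insert_of_mem _ hi, h'⟩

end ultrafilter_facts

section ring_facts

theorem isSetRing_ring (v : Λ) : MeasureTheory.IsSetRing (ring v) := isSetRing_generatedRing _

theorem Zigzag.domain_mem_ring {w v : Λ} (ζ : Zigzag w v) : ζ.domain ∈ ring v := by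
  rcases Set.eq_empty_or_nonempty ζ.domain with h | h
  · rw [h]; exact (isSetRing_ring v).empty_mem
  · exact subset_generatedRing _ ⟨h, w, ζ, rfl⟩

/-- Induction principle for membership in `𝒜_v`. -/
theorem ring_induction {v : Λ} {p : Set (PathsTo v) → Prop} (h0 : p ∅)
    (hζ : ∀ {w : Λ} (ζ : Zigzag w v), p ζ.domain)
    (hu : ∀ E F, p E → p F → p (E ∪ F)) (hd : ∀ E F, p E → p F → p (E \ F))
    {E : Set (PathsTo v)} (hE : E ∈ ring v) : p E :=
  hE {E | p E} ⟨h0, fun _ _ => hu _ _, fun _ _ => hd _ _⟩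
    (by rintro _ ⟨-, w, ζ, rfl⟩; exact hζ ζ)

theorem concat_id {v : Λ} (γ : PathsTo v) : concat (𝟙 v) γ = γ := by simp [concat]

theorem concat_comp {t w v : Λ} (δ : t ⟶ w) (α : w ⟶ v) (γ : PathsTo t) :
    concat (δ ≫ α) γ = concat α (concat δ γ) := by simp [concat]

theorem mem_tail_self {v : Λ} (α : PathsTo v) : α ∈ tail α :=
  ⟨⟨α.1, 𝟙 _⟩, by simp [concat]⟩

theorem univ_mem_ring (v : Λ) : (Set.univ : Set (PathsTo v)) ∈ ring v := by
  convert (Zigzag.single (𝟙 v) (𝟙 v)).domain_mem_ring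
  ext γ
  exact ⟨fun _ => ⟨γ, (Zigzag.graph_single _ _ _ _).2 rfl⟩, fun _ => trivial⟩

theorem preimage_concat_mem_ring {w v : Λ} (α : w ⟶ v) {E : Set (PathsTo v)} (hE : E ∈ ring v) :
    concat α ⁻¹' E ∈ ring w := by
  refine ring_induction (p := fun E => concat α ⁻¹' E ∈ ring w) ?_ ?_ ?_ ?_ hE
  · exact (isSetRing_ring w).empty_mem
  · intro t ζ
    convert (Zigzag.snoc ζ (𝟙 v) α).domain_mem_ring
    ext γ
    simp [Zigzag.domain, Zigzag.Graph, concat_id]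
  · exact fun E F h h' => (isSetRing_ring w).union_mem h h'
  · exact fun E F h h' => (isSetRing_ring w).sdiff_mem h h'

theorem tail_mem_ring {v : Λ} (α : PathsTo v) : tail α ∈ ring v := by
  convert (Zigzag.single α.2 (𝟙 v)).domain_mem_ring
  ext γ
  simp [Zigzag.domain, Zigzag.Graph, concat_id, tail]

theorem concat_injective [CategoryOfPaths Λ] {w v : Λ} (α : w ⟶ v) :
    Function.Injective (concat α) := by
  rintro ⟨a, β⟩ ⟨b, γ⟩ h
  simp only [concat, Sigma.mk.injEq] at h
  obtain ⟨rfl, h⟩ := h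
  rw [CategoryOfPaths.left_cancel α β γ (eq_of_heq h)]

theorem image_concat_mem_ring [CategoryOfPaths Λ] {w v : Λ} (α : w ⟶ v) {E : Set (PathsTo w)}
    (hE : E ∈ ring w) : concat α '' E ∈ ring v := by
  refine ring_induction (p := fun E => concat α '' E ∈ ring v) ?_ ?_ ?_ ?_ hE
  · rw [Set.image_empty]; exact (isSetRing_ring v).empty_mem
  · intro t ζ
    convert (Zigzag.snoc ζ α (𝟙 v)).domain_mem_ring
    ext γ
    constructor
    · rintro ⟨δ, ⟨ε, hε⟩, rfl⟩
      exact ⟨ε, (Zigzag.graph_snoc _ _ _ _ _).2 ⟨δ, (concat_id _).symm, hε⟩⟩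
    · rintro ⟨ε, h⟩
      obtain ⟨δ, h, hε⟩ := (Zigzag.graph_snoc _ _ _ _ _).1 h
      exact ⟨δ, ⟨ε, hε⟩, h.trans (concat_id _)⟩
  · intro E F h h'
    rw [Set.image_union]; exact (isSetRing_ring v).union_mem h h'
  · intro E F h h'
    rw [Set.image_sdiff (concat_injective α)]; exact (isSetRing_ring v).sdiff_mem h h'

theorem Zigzag.graph_extend {w v : Λ} (ζ : Zigzag w v) :
    ∀ (a : Λ) (γ : a ⟶ v) (b : Λ) (δ : b ⟶ w), ζ.Graph ⟨a, γ⟩ ⟨b, δ⟩ →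
      ∀ (t : Λ) (τ : t ⟶ a), ∃ δ', ζ.Graph ⟨t, τ ≫ γ⟩ δ' := by
  suffices H : ∀ (a : Λ) (γ : a ⟶ v) (b : Λ) (δ : b ⟶ w), ζ.Graph ⟨a, γ⟩ ⟨b, δ⟩ →
      ∃ h : a = b, ∀ (t : Λ) (τ : t ⟶ a), ζ.Graph ⟨t, τ ≫ γ⟩ ⟨t, τ ≫ eqToHom h ≫ δ⟩ from
    fun a γ b δ h t τ => ⟨_, (H a γ b δ h).2 t τ⟩
  induction ζ with
  | single α β =>
    intro a γ b δ h
    simp only [Zigzag.Graph, concat, Sigma.mk.injEq] at h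
    obtain ⟨rfl, h⟩ := h
    refine ⟨rfl, fun t τ => ?_⟩
    simp [Zigzag.Graph, concat, eq_of_heq h]
  | snoc ζ α β ih =>
    intro a γ b δ h
    obtain ⟨⟨c, ε⟩, h₁, h'⟩ := (Zigzag.graph_snoc _ _ _ _ _).1 h
    simp only [concat, Sigma.mk.injEq] at h₁
    obtain ⟨rfl, h₁⟩ := h₁
    obtain ⟨rfl, h''⟩ := ih _ _ _ _ h'
    refine ⟨rfl, fun t τ => (Zigzag.graph_snoc _ _ _ _ _).2 ⟨⟨t, τ ≫ ε⟩, ?_, h'' t τ⟩⟩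
    simp [concat, eq_of_heq h₁]

theorem Zigzag.tail_subset_domain {w v : Λ} (ζ : Zigzag w v) {γ : PathsTo v}
    (hγ : γ ∈ ζ.domain) : tail γ ⊆ ζ.domain := by
  obtain ⟨δ, hδ⟩ := hγ
  rintro _ ⟨τ, rfl⟩
  exact ζ.graph_extend _ _ _ _ hδ τ.1 τ.2

end ring_facts

/-! ### Directed sets and the ultrafilters defined by them -/

/-- `C ⊆ vΛ` is directed: any two elements of `C` have a common extension in `C`. -/
def IsDirectedSet {v : Λ} (C : Set (PathsTo v)) : Prop :=
  ∀ α ∈ C, ∀ β ∈ C, (tail α ∩ tail β ∩ C).Nonempty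

/-- The set `vΛ**` of maximal directed subsets of `vΛ`. -/
def maximalDirectedSets (v : Λ) : Set (Set (PathsTo v)) := {C | Maximal IsDirectedSet C}

/-- `𝒰_C = {E ∈ 𝒜_v | E ⊇ C ∩ αΛ for some α ∈ C}`. -/
def directedFilter {v : Λ} (C : Set (PathsTo v)) : Set (Set (PathsTo v)) :=
  {E | E ∈ ring v ∧ ∃ α ∈ C, C ∩ tail α ⊆ E}

theorem tail_subset_tail {v : Λ} {α β : PathsTo v} (h : β ∈ tail α) : tail β ⊆ tail α := by
  obtain ⟨γ, rfl⟩ := h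
  rintro _ ⟨δ, rfl⟩
  exact ⟨concat γ.2 δ, by simp [concat]⟩

theorem nonempty_of_mem_maximalDirectedSets {v : Λ} {C : Set (PathsTo v)}
    (hC : C ∈ maximalDirectedSets v) : C.Nonempty := by
  by_contra h
  rw [Set.not_nonempty_iff_eq_empty] at h
  subst h
  let o : PathsTo v := ⟨v, 𝟙 v⟩
  have h1 : IsDirectedSet ({o} : Set (PathsTo v)) := by
    rintro α rfl β rfl
    exact ⟨o, ⟨mem_tail_self o, mem_tail_self o⟩, rfl⟩
  exact hC.2 h1 (Set.empty_subset _) rfl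

theorem isUltrafilterIn_directedFilter {v : Λ} {C : Set (PathsTo v)} (hC : IsDirectedSet C)
    (hne : C.Nonempty) : IsUltrafilterIn (ring v) (directedFilter C) := by
  have dir : ∀ α ∈ C, ∀ β ∈ C, ∃ γ ∈ C, tail γ ⊆ tail α ∩ tail β := fun α hα β hβ => by
    obtain ⟨γ, ⟨h1, h2⟩, h3⟩ := hC α hα β hβ
    exact ⟨γ, h3, Set.subset_inter (tail_subset_tail h1) (tail_subset_tail h2)⟩
  obtain ⟨α₀, hα₀⟩ := hne
  have dich : ∀ E ∈ ring v, (∃ α ∈ C, C ∩ tail α ⊆ E) ∨ ∃ α ∈ C, C ∩ tail α ⊆ Eᶜ := by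
    intro E hE
    refine ring_induction (p := fun E => (∃ α ∈ C, C ∩ tail α ⊆ E) ∨ ∃ α ∈ C, C ∩ tail α ⊆ Eᶜ)
      ?_ ?_ ?_ ?_ hE
    · exact Or.inr ⟨α₀, hα₀, by simp⟩
    · intro w ζ
      by_cases h : ∃ α ∈ C, α ∈ ζ.domain
      · obtain ⟨α, hα, h⟩ := h
        exact Or.inl ⟨α, hα, Set.inter_subset_right.trans (ζ.tail_subset_domain h)⟩
      · push Not at h
        exact Or.inr ⟨α₀, hα₀, fun γ hγ => h γ hγ.1⟩
    · rintro E F (⟨α, hα, h⟩ | ⟨α, hα, h⟩) hF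
      · exact Or.inl ⟨α, hα, h.trans Set.subset_union_left⟩
      · rcases hF with ⟨β, hβ, h'⟩ | ⟨β, hβ, h'⟩
        · exact Or.inl ⟨β, hβ, h'.trans Set.subset_union_right⟩
        · obtain ⟨γ, hγ, hs⟩ := dir α hα β hβ
          refine Or.inr ⟨γ, hγ, fun t ht => ?_⟩
          rintro (h1 | h1)
          · exact h ⟨ht.1, (hs ht.2).1⟩ h1
          · exact h' ⟨ht.1, (hs ht.2).2⟩ h1
    · rintro E F (⟨α, hα, h⟩ | ⟨α, hα, h⟩) hF
      · rcases hF with ⟨β, hβ, h'⟩ | ⟨β, hβ, h'⟩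
        · exact Or.inr ⟨β, hβ, fun t ht h1 => h1.2 (h' ht)⟩
        · obtain ⟨γ, hγ, hs⟩ := dir α hα β hβ
          exact Or.inl ⟨γ, hγ, fun t ht => ⟨h ⟨ht.1, (hs ht.2).1⟩, h' ⟨ht.1, (hs ht.2).2⟩⟩⟩
      · exact Or.inr ⟨α, hα, fun t ht h1 => h ht h1.1⟩
  refine (isUltrafilterIn_iff (isSetRing_ring v)).2 ⟨⟨fun _ h => h.1, ?_, ?_, ?_, ?_⟩, ?_⟩
  · exact ⟨Set.univ, univ_mem_ring v, α₀, hα₀, Set.subset_univ _⟩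
  · rintro E ⟨-, α, hα, h⟩
    exact ⟨α, h ⟨hα, mem_tail_self α⟩⟩
  · rintro E ⟨hE, α, hα, h⟩ F ⟨hF, β, hβ, h'⟩
    obtain ⟨γ, hγ, hs⟩ := dir α hα β hβ
    exact ⟨(isSetRing_ring v).inter_mem hE hF, γ, hγ,
      fun t ht => ⟨h ⟨ht.1, (hs ht.2).1⟩, h' ⟨ht.1, (hs ht.2).2⟩⟩⟩
  · rintro E ⟨-, α, hα, h⟩ F hF hEF
    exact ⟨hF, α, hα, h.trans hEF⟩
  · intro E hE
    rcases dich E hE with ⟨α, hα, h⟩ | ⟨α, hα, h⟩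
    · exact Or.inl ⟨hE, α, hα, h⟩
    · refine Or.inr ⟨Set.univ \ E, ⟨(isSetRing_ring v).sdiff_mem (univ_mem_ring v) hE, α, hα,
        fun t ht => ⟨trivial, h ht⟩⟩, by simp⟩

/-- The point of `X_v` defined by a maximal directed subset of `vΛ`. -/
def maximalPoint {v : Λ} (C : Set (PathsTo v)) (hC : C ∈ maximalDirectedSets v) : X v :=
  ⟨directedFilter C, isUltrafilterIn_directedFilter hC.1 (nonempty_of_mem_maximalDirectedSets hC)⟩

/-! ### The unit space and the boundary -/

variable (Λ) in
/-- The unit space `X`, the disjoint union of the spaces `X_v`. -/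
def UnitSpace : Type (max u v) := Σ v : Λ, X v

instance : TopologicalSpace (UnitSpace Λ) := inferInstanceAs (TopologicalSpace (Σ v : Λ, X v))

variable (Λ) in
/-- The boundary `∂Λ`: the closure in `X` of the set `Λ**` of maximal directed sets. -/
def boundary : Set (UnitSpace Λ) :=
  closure {x | ∃ (v : Λ) (C : Set (PathsTo v)) (hC : C ∈ maximalDirectedSets v),
    x = ⟨v, maximalPoint C hC⟩}

/-! ### Concatenation of a path with a point of `X` -/

/-- The collection `{E ∈ 𝒜_{r(α)} | E ⊇ αF for some F ∈ 𝒰}`: the filter with base `α𝒰`. -/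
def concatFilter {w v : Λ} (α : w ⟶ v) (𝒰 : Set (Set (PathsTo w))) : Set (Set (PathsTo v)) :=
  {E | E ∈ ring v ∧ ∃ F ∈ 𝒰, concat α '' F ⊆ E}

theorem mem_concatFilter {w v : Λ} (α : w ⟶ v) (x : X w) {E : Set (PathsTo v)} :
    E ∈ concatFilter α x.1 ↔ E ∈ ring v ∧ concat α ⁻¹' E ∈ x.1 := by
  refine and_congr_right fun hE => ⟨?_, fun h => ⟨_, h, Set.image_preimage_subset _ _⟩⟩
  rintro ⟨F, hF, h⟩
  exact x.2.1.superset_mem F hF _ (preimage_concat_mem_ring α hE) (Set.image_subset_iff.1 h)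

variable [CategoryOfPaths Λ]

theorem isUltrafilterIn_concatFilter {w v : Λ} (α : w ⟶ v) (x : X w) :
    IsUltrafilterIn (ring v) (concatFilter α x.1) := by
  have hx := (isUltrafilterIn_iff (isSetRing_ring w)).1 x.2
  refine (isUltrafilterIn_iff (isSetRing_ring v)).2 ⟨⟨fun _ h => h.1, ?_, ?_, ?_, ?_⟩, ?_⟩
  · obtain ⟨F, hF⟩ := hx.1.nonempty
    exact ⟨Set.univ, univ_mem_ring v, F, hF, Set.subset_univ _⟩
  · rintro E ⟨-, F, hF, h⟩
    exact ((hx.1.nonempty_of_mem F hF).image _).mono h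
  · intro E hE F hF
    rw [mem_concatFilter] at *
    exact ⟨(isSetRing_ring v).inter_mem hE.1 hF.1, hx.1.inter_mem _ hE.2 _ hF.2⟩
  · rintro E ⟨-, F, hF, h⟩ E' hE' hEE'
    exact ⟨hE', F, hF, h.trans hEE'⟩
  · intro E hE
    rcases hx.2 _ (preimage_concat_mem_ring α hE) with h | ⟨F, hF, h⟩
    · exact Or.inl ((mem_concatFilter α x).2 ⟨hE, h⟩)
    · refine Or.inr ⟨concat α '' F, ⟨image_concat_mem_ring α (hx.1.subset hF), F, hF,
        subset_rfl⟩, ?_⟩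
      rw [Set.eq_empty_iff_forall_notMem] at h ⊢
      rintro _ ⟨h1, γ, hγ, rfl⟩
      exact h γ ⟨h1, hγ⟩

/-- The point `αx ∈ X_{r(α)}`, for `x ∈ X_{s(α)}`: the ultrafilter with base `α𝒰_x`. -/
def act {w v : Λ} (α : w ⟶ v) (x : X w) : X v :=
  ⟨concatFilter α x.1, isUltrafilterIn_concatFilter α x⟩

theorem mem_act {w v : Λ} (α : w ⟶ v) (x : X w) {E : Set (PathsTo v)} :
    E ∈ (act α x).1 ↔ E ∈ ring v ∧ concat α ⁻¹' E ∈ x.1 := mem_concatFilter α x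

theorem act_id {v : Λ} (x : X v) : act (𝟙 v) x = x := by
  apply Subtype.ext
  ext E
  rw [mem_act]
  have : concat (𝟙 v) ⁻¹' E = E := by ext γ; simp [concat_id]
  rw [this]
  exact ⟨fun h => h.2, fun h => ⟨x.2.1.subset h, h⟩⟩

theorem act_comp {t w v : Λ} (δ : t ⟶ w) (α : w ⟶ v) (x : X t) :
    act (δ ≫ α) x = act α (act δ x) := by
  apply Subtype.ext
  ext E
  rw [mem_act, mem_act, mem_act]
  have : concat (δ ≫ α) ⁻¹' E = concat δ ⁻¹' (concat α ⁻¹' E) := by ext γ; simp [concat_comp]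
  rw [this]
  exact ⟨fun h => ⟨h.1, preimage_concat_mem_ring α h.1, h.2⟩, fun h => ⟨h.1, h.2.2⟩⟩

theorem act_injective {w v : Λ} (α : w ⟶ v) : Function.Injective (act α) := by
  intro x y h
  apply Subtype.ext
  refine x.2.eq_of_subset y.2 fun E hE => ?_
  have h1 : concat α '' E ∈ (act α x).1 :=
    ⟨image_concat_mem_ring α (x.2.1.subset hE), E, hE, subset_rfl⟩
  rw [h, mem_act, Set.preimage_image_eq _ (concat_injective α)] at h1
  exact h1.2

theorem exists_act_eq {w v : Λ} (α : w ⟶ v) (y : X v) (hy : tail ⟨w, α⟩ ∈ y.1) :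
    ∃ x : X w, act α x = y := by
  have hu := (isUltrafilterIn_iff (isSetRing_ring v)).1 y.2
  have key : IsUltrafilterIn (ring w) {F | F ∈ ring w ∧ concat α '' F ∈ y.1} := by
    refine (isUltrafilterIn_iff (isSetRing_ring w)).2 ⟨⟨fun _ h => h.1, ?_, ?_, ?_, ?_⟩, ?_⟩
    · exact ⟨Set.univ, univ_mem_ring w, by rw [Set.image_univ]; exact hy⟩
    · rintro E ⟨-, h⟩
      exact Set.image_nonempty.1 (hu.1.nonempty_of_mem _ h)
    · rintro E ⟨h1, h2⟩ F ⟨h3, h4⟩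
      refine ⟨(isSetRing_ring w).inter_mem h1 h3, ?_⟩
      rw [Set.image_inter (concat_injective α)]
      exact hu.1.inter_mem _ h2 _ h4
    · rintro E ⟨h1, h2⟩ F hF hEF
      exact ⟨hF, hu.1.superset_mem _ h2 _ (image_concat_mem_ring α hF) (Set.image_mono hEF)⟩
    · intro E hE
      rcases hu.2 _ (image_concat_mem_ring α hE) with h | ⟨F, hF, h⟩
      · exact Or.inl ⟨hE, h⟩
      · refine Or.inr ⟨concat α ⁻¹' F, ⟨preimage_concat_mem_ring α (hu.1.subset hF), ?_⟩, ?_⟩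
        · rw [Set.image_preimage_eq_inter_range]
          exact hu.1.inter_mem _ hF _ hy
        · rw [Set.eq_empty_iff_forall_notMem] at h ⊢
          exact fun γ hγ => h _ ⟨⟨γ, hγ.1, rfl⟩, hγ.2⟩
  refine ⟨⟨_, key⟩, Subtype.ext ?_⟩
  refine (act α ⟨_, key⟩).2.eq_of_subset y.2 ?_
  rintro E ⟨hE, F, hF, h⟩
  exact hu.1.superset_mem _ hF.2 _ hE h

theorem tail_mem_act {w v : Λ} (α : w ⟶ v) (x : X w) : tail ⟨w, α⟩ ∈ (act α x).1 := by
  obtain ⟨F, hF⟩ := x.2.1.nonempty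
  exact ⟨tail_mem_ring _, F, hF, Set.image_subset_range _ _⟩

/-- Points with `αx = α'x'` have a common tail. -/
theorem exists_common_tail [FinitelyAligned Λ] {w w' v : Λ} {α : w ⟶ v} {α' : w' ⟶ v}
    {x : X w} {x' : X w'} (h : act α x = act α' x') :
    ∃ (t : Λ) (δ : t ⟶ w) (δ' : t ⟶ w') (z : X t),
      x = act δ z ∧ x' = act δ' z ∧ δ ≫ α = δ' ≫ α' := by
  obtain ⟨G, hG, hGe⟩ := FinitelyAligned.exists_finite (⟨w, α⟩ : PathsTo v) ⟨w', α'⟩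
  have h1 : (⋃ ε ∈ G, tail ε) ∈ (act α x).1 := by
    rw [← hGe]
    exact (act α x).2.1.inter_mem _ (tail_mem_act α x) _ (h ▸ tail_mem_act α' x')
  obtain ⟨⟨t, ε⟩, hε, hεm⟩ := (act α x).2.exists_mem_of_biUnion (isSetRing_ring v) hG _
    (fun ε _ => tail_mem_ring ε) h1
  have h2 : (⟨t, ε⟩ : PathsTo v) ∈ tail (⟨w, α⟩ : PathsTo v) ∩ tail ⟨w', α'⟩ := by
    rw [hGe]; exact Set.mem_biUnion hε (mem_tail_self _)
  obtain ⟨⟨⟨_, δ⟩, hδ⟩, ⟨⟨_, δ'⟩, hδ'⟩⟩ := h2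
  simp only [concat, Sigma.mk.injEq] at hδ hδ'
  obtain ⟨rfl, hδ⟩ := hδ
  obtain ⟨rfl, hδ'⟩ := hδ'
  have hδ := eq_of_heq hδ
  have hδ' := eq_of_heq hδ'
  obtain ⟨z, hz⟩ := exists_act_eq ε _ hεm
  refine ⟨_, δ, δ', z, act_injective α ?_, act_injective α' ?_, hδ.trans hδ'.symm⟩
  · rw [← act_comp, hδ, hz]
  · rw [← act_comp, hδ', hz, h]

/-! ### The groupoid -/

/-- A triple `(α, β, z)` with `α, β ∈ Λv` and `z ∈ X_v`, such that `βz = x` and `αz = y`. It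
represents an element of the groupoid with source `x` and range `y`. -/
structure Triple (x y : UnitSpace Λ) where
  /-- the common source of `α` and `β` -/
  v : Λ
  α : v ⟶ y.1
  β : v ⟶ x.1
  z : X v
  range_eq : act α z = y.2
  source_eq : act β z = x.2

namespace Triple

/-- `(α, β, z) ∼ (α', β', z')` if there are `t`, `δ`, `δ'` with `z = δt`, `z' = δ't`,
`αδ = α'δ'` and `βδ = β'δ'`. (This forces `αz = α'z'` and `βz = β'z'`, so it suffices to compare
triples with the same source and the same range.) -/
def Rel {x y : UnitSpace Λ} (p q : Triple x y) : Prop :=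
  ∃ (w : Λ) (t : X w) (δ : w ⟶ p.v) (δ' : w ⟶ q.v),
    p.z = act δ t ∧ q.z = act δ' t ∧ δ ≫ p.α = δ' ≫ q.α ∧ δ ≫ p.β = δ' ≫ q.β

variable [FinitelyAligned Λ]

theorem rel_equivalence (x y : UnitSpace Λ) : Equivalence (Rel (x := x) (y := y)) where
  refl p := ⟨p.v, p.z, 𝟙 _, 𝟙 _, (act_id _).symm, (act_id _).symm, rfl, rfl⟩
  symm := by
    rintro p q ⟨w, t, δ, δ', h1, h2, h3, h4⟩
    exact ⟨w, t, δ', δ, h2, h1, h3.symm, h4.symm⟩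
  trans := by
    rintro p q r ⟨w, t, δ, δ', h1, h2, h3, h4⟩ ⟨w', t', ε, ε', k1, k2, k3, k4⟩
    obtain ⟨s, η, θ, z, e1, e2, e3⟩ := exists_common_tail (h2.symm.trans k1)
    refine ⟨s, z, η ≫ δ, θ ≫ ε', ?_, ?_, ?_, ?_⟩
    · rw [h1, e1, act_comp]
    · rw [k2, e2, act_comp]
    · rw [Category.assoc, h3, ← Category.assoc, e3, Category.assoc, k3, Category.assoc]
    · rw [Category.assoc, h4, ← Category.assoc, e3, Category.assoc, k4, Category.assoc]

instance setoid (x y : UnitSpace Λ) : Setoid (Triple x y) := ⟨Rel, rel_equivalence x y⟩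

/-- The triple `(αξ, δη, t)`, which represents the product `[α, β, z] [γ, δ, z']` when
`z = ξt`, `z' = ηt` and `βξ = γη`. -/
def prod {x y w : UnitSpace Λ} (q : Triple y w) (p : Triple x y) {s : Λ} (ξ : s ⟶ q.v)
    (η : s ⟶ p.v) (t : X s) (h1 : q.z = act ξ t) (h2 : p.z = act η t) : Triple x w where
  v := s
  α := ξ ≫ q.α
  β := η ≫ p.β
  z := t
  range_eq := by rw [act_comp, ← h1, q.range_eq]
  source_eq := by rw [act_comp, ← h2, p.source_eq]

theorem exists_prod {x y w : UnitSpace Λ} (q : Triple y w) (p : Triple x y) :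
    ∃ (s : Λ) (ξ : s ⟶ q.v) (η : s ⟶ p.v) (t : X s),
      q.z = act ξ t ∧ p.z = act η t ∧ ξ ≫ q.β = η ≫ p.α :=
  exists_common_tail (q.source_eq.trans p.range_eq.symm)

/-- If equivalent triples have representatives along `κ`, `κ'` which agree in `β`, then after
passing to a further tail they agree in `α`. -/
theorem Rel.alpha_eq {x y : UnitSpace Λ} {p p' : Triple x y} (h : Rel p p') {s : Λ}
    {κ : s ⟶ p.v} {κ' : s ⟶ p'.v} {t : X s} (h1 : p.z = act κ t) (_h2 : p'.z = act κ' t)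
    (hβ : κ ≫ p.β = κ' ≫ p'.β) : κ ≫ p.α = κ' ≫ p'.α := by
  obtain ⟨w, r, δ, δ', k1, k2, k3, k4⟩ := h
  obtain ⟨a, η, θ, z, e1, e2, e3⟩ := exists_common_tail (k1.symm.trans h1)
  have e4 : η ≫ δ' = θ ≫ κ' := by
    apply CategoryOfPaths.left_cancel p'.β
    rw [Category.assoc, ← k4, ← Category.assoc, e3, Category.assoc, hβ, Category.assoc]
  apply CategoryOfPaths.right_cancel θ
  rw [← Category.assoc, ← e3, Category.assoc, k3, ← Category.assoc, e4, Category.assoc]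

theorem Rel.beta_eq {x y : UnitSpace Λ} {p p' : Triple x y} (h : Rel p p') {s : Λ}
    {κ : s ⟶ p.v} {κ' : s ⟶ p'.v} {t : X s} (h1 : p.z = act κ t) (_h2 : p'.z = act κ' t)
    (hα : κ ≫ p.α = κ' ≫ p'.α) : κ ≫ p.β = κ' ≫ p'.β := by
  obtain ⟨w, r, δ, δ', k1, k2, k3, k4⟩ := h
  obtain ⟨a, η, θ, z, e1, e2, e3⟩ := exists_common_tail (k1.symm.trans h1)
  have e4 : η ≫ δ' = θ ≫ κ' := by
    apply CategoryOfPaths.left_cancel p'.α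
    rw [Category.assoc, ← k3, ← Category.assoc, e3, Category.assoc, hα, Category.assoc]
  apply CategoryOfPaths.right_cancel θ
  rw [← Category.assoc, ← e3, Category.assoc, k4, ← Category.assoc, e4, Category.assoc]

/-- The product does not depend on the representatives or on the common tail. -/
theorem prod_rel {x y w : UnitSpace Λ} {q q' : Triple y w} {p p' : Triple x y}
    (hq : Rel q q') (hp : Rel p p')
    {s : Λ} {ξ : s ⟶ q.v} {η : s ⟶ p.v} {t : X s} (h1 : q.z = act ξ t) (h2 : p.z = act η t)
    (h3 : ξ ≫ q.β = η ≫ p.α)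
    {s' : Λ} {ξ' : s' ⟶ q'.v} {η' : s' ⟶ p'.v} {t' : X s'} (h1' : q'.z = act ξ' t')
    (h2' : p'.z = act η' t') (h3' : ξ' ≫ q'.β = η' ≫ p'.α) :
    Rel (prod q p ξ η t h1 h2) (prod q' p' ξ' η' t' h1' h2') := by
  have h : act (ξ ≫ q.β) t = act (ξ' ≫ q'.β) t' := by
    rw [act_comp, act_comp, ← h1, ← h1', q.source_eq, q'.source_eq]
  obtain ⟨a, θ, θ', z, e1, e2, e3⟩ := exists_common_tail h
  refine ⟨a, z, θ, θ', e1, e2, ?_, ?_⟩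
  · have := hq.alpha_eq (κ := θ ≫ ξ) (κ' := θ' ≫ ξ') (t := z) (by rw [h1, e1, act_comp])
      (by rw [h1', e2, act_comp]) (by simpa using e3)
    simpa [prod] using this
  · rw [h3, h3'] at e3
    have := hp.beta_eq (κ := θ ≫ η) (κ' := θ' ≫ η') (t := z) (by rw [h2, e1, act_comp])
      (by rw [h2', e2, act_comp]) (by simpa using e3)
    simpa [prod] using this

end Triple

variable [FinitelyAligned Λ]

/-- The elements `[α, β, z]` of the groupoid `G` with source `x` and range `y`. -/
def Arrow (x y : UnitSpace Λ) : Type (max u v) := Quotient (Triple.setoid x y)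

namespace Arrow

/-- The unit `[r(x), r(x), x]`. -/
def id (x : UnitSpace Λ) : Arrow x x := ⟦⟨x.1, 𝟙 _, 𝟙 _, x.2, act_id _, act_id _⟩⟧

/-- Inversion `[α, β, z]⁻¹ = [β, α, z]`. -/
def inv {x y : UnitSpace Λ} : Arrow x y → Arrow y x :=
  Quotient.map (fun p => ⟨p.v, p.β, p.α, p.z, p.source_eq, p.range_eq⟩) (by
    rintro p q ⟨w, t, δ, δ', h1, h2, h3, h4⟩
    exact ⟨w, t, δ, δ', h1, h2, h4, h3⟩)

/-- Multiplication: `[α, β, z] [γ, δ, z'] = [αξ, δη, t]` where `z = ξt`, `z' = ηt` and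
`βξ = γη`. -/
noncomputable def mul {x y w : UnitSpace Λ} : Arrow y w → Arrow x y → Arrow x w :=
  Quotient.map₂ (fun q p =>
    let h := Triple.exists_prod q p
    let h' := h.choose_spec.choose_spec.choose_spec.choose_spec
    Triple.prod q p h.choose_spec.choose h.choose_spec.choose_spec.choose
      h.choose_spec.choose_spec.choose_spec.choose h'.1 h'.2.1) (by
    intro q q' hq p p' hp
    exact Triple.prod_rel hq hp _ _
      (Triple.exists_prod q p).choose_spec.choose_spec.choose_spec.choose_spec.2.2 _ _
      (Triple.exists_prod q' p').choose_spec.choose_spec.choose_spec.choose_spec.2.2)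

theorem mul_mk {x y w : UnitSpace Λ} (q : Triple y w) (p : Triple x y) {s : Λ} (ξ : s ⟶ q.v)
    (η : s ⟶ p.v) (t : X s) (h1 : q.z = act ξ t) (h2 : p.z = act η t)
    (h3 : ξ ≫ q.β = η ≫ p.α) :
    mul (⟦q⟧ : Arrow y w) (⟦p⟧ : Arrow x y) = (⟦Triple.prod q p ξ η t h1 h2⟧ : Arrow x w) :=
  Quotient.sound (Triple.prod_rel (Setoid.refl q) (Setoid.refl p) _ _
    (Triple.exists_prod q p).choose_spec.choose_spec.choose_spec.choose_spec.2.2 h1 h2 h3)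

theorem id_mul {x y : UnitSpace Λ} (g : Arrow x y) : mul (id y) g = g := by
  induction g using Quotient.ind with | _ p => ?_
  refine (mul_mk _ p p.α (𝟙 _) p.z p.range_eq.symm (act_id _).symm (by simp)).trans ?_
  exact Quotient.sound ⟨p.v, p.z, 𝟙 _, 𝟙 _, (act_id _).symm, (act_id _).symm,
    by simp [Triple.prod], by simp [Triple.prod]⟩

theorem mul_id {x y : UnitSpace Λ} (g : Arrow x y) : mul g (id x) = g := by
  induction g using Quotient.ind with | _ p => ?_
  refine (mul_mk p _ (𝟙 _) p.β p.z (act_id _).symm p.source_eq.symm (by simp)).trans ?_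
  exact Quotient.sound ⟨p.v, p.z, 𝟙 _, 𝟙 _, (act_id _).symm, (act_id _).symm,
    by simp [Triple.prod], by simp [Triple.prod]⟩

theorem inv_mul {x y : UnitSpace Λ} (g : Arrow x y) : mul (inv g) g = id x := by
  induction g using Quotient.ind with | _ p => ?_
  refine (mul_mk ⟨p.v, p.β, p.α, p.z, p.source_eq, p.range_eq⟩ p (𝟙 _) (𝟙 _) p.z
    (act_id _).symm (act_id _).symm rfl).trans ?_
  exact Quotient.sound ⟨p.v, p.z, 𝟙 _, p.β, (act_id _).symm, p.source_eq.symm,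
    by simp [Triple.prod], by simp [Triple.prod]⟩

theorem mul_inv {x y : UnitSpace Λ} (g : Arrow x y) : mul g (inv g) = id y := by
  have h := inv_mul (inv g)
  have : inv (inv g) = g := by
    induction g using Quotient.ind with | _ p => rfl
  rwa [this] at h

theorem mul_assoc {x y w u : UnitSpace Λ} (k : Arrow w u) (h : Arrow y w) (g : Arrow x y) :
    mul (mul k h) g = mul k (mul h g) := by
  induction g using Quotient.ind with | _ p => ?_
  induction h using Quotient.ind with | _ q => ?_
  induction k using Quotient.ind with | _ r => ?_
  obtain ⟨s, ξ, η, t, h1, h2, h3⟩ := Triple.exists_prod q p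
  obtain ⟨s', ξ', η', t', k1, k2, k3⟩ := Triple.exists_prod r q
  obtain ⟨a, θ, θ', z, e1, e2, e3⟩ := exists_common_tail (h1.symm.trans k2)
  -- all three factors are restricted to the common tail `z`
  have hr : r.z = act (θ' ≫ ξ') z := by rw [k1, e2, act_comp]
  have hq : q.z = act (θ ≫ ξ) z := by rw [h1, e1, act_comp]
  have hp : p.z = act (θ ≫ η) z := by rw [h2, e1, act_comp]
  have hqp : (θ ≫ ξ) ≫ q.β = (θ ≫ η) ≫ p.α := by simp [h3]
  have hrq : (θ' ≫ ξ') ≫ r.β = (θ ≫ ξ) ≫ q.α := by rw [e3]; simp [k3]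
  rw [mul_mk q p _ _ z hq hp hqp, mul_mk r q _ _ z hr hq hrq,
    mul_mk (Triple.prod r q _ _ z hr hq) p (𝟙 a) (θ ≫ η) z (act_id _).symm hp
      (by simpa [Triple.prod] using hqp),
    mul_mk r (Triple.prod q p _ _ z hq hp) (θ' ≫ ξ') (𝟙 a) z hr (act_id _).symm
      (by simpa [Triple.prod] using hrq)]
  exact Quotient.sound ⟨a, z, 𝟙 _, 𝟙 _, (act_id _).symm, (act_id _).symm,
    by simp [Triple.prod], by simp [Triple.prod]⟩

end Arrow

/-- The groupoid `G = G(Λ)`, with unit space `X`; a morphism `x ⟶ y` is an element with source `x`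
and range `y`, and `g ≫ h` is the product `hg`. -/
noncomputable instance : Groupoid (UnitSpace Λ) where
  Hom x y := Arrow x y
  id x := Arrow.id x
  comp g h := Arrow.mul h g
  id_comp g := Arrow.mul_id g
  comp_id g := Arrow.id_mul g
  assoc g h k := (Arrow.mul_assoc k h g).symm
  inv g := Arrow.inv g
  inv_comp g := Arrow.mul_inv g
  comp_inv g := Arrow.inv_mul g

/-! ### Restriction to the boundary, and minimality -/

/-- The restriction `G|_Y` of the groupoid to a set `Y` of units: all elements with source and
range in `Y`. -/
noncomputable instance restriction {Y : Type*} [Groupoid Y] (S : Set Y) : Groupoid S where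
  Hom x y := (x : Y) ⟶ y
  id x := 𝟙 (x : Y)
  comp g h := CategoryStruct.comp (obj := Y) g h
  id_comp g := Category.id_comp (obj := Y) g
  comp_id g := Category.comp_id (obj := Y) g
  assoc g h k := Category.assoc (obj := Y) g h k
  inv g := Groupoid.inv (obj := Y) g
  inv_comp g := Groupoid.inv_comp (obj := Y) g
  comp_inv g := Groupoid.comp_inv (obj := Y) g

/-- A topological groupoid with unit space `Y` is minimal if every orbit
`{r(g) | s(g) = x}` is dense in `Y`. (Only the topology of the unit space matters.) -/
def IsMinimalGroupoid (Y : Type*) [TopologicalSpace Y] [Groupoid Y] : Prop :=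
  ∀ x : Y, Dense {y : Y | Nonempty (x ⟶ y)}

end PathCat

/-! An element `[α, β, z]` moves `βz` to `αz`, so the orbit of `x` reaches `X_u` exactly when `x`
contains the tail set of some `β` for which there is a path from `s(β)` to `u`. Both directions
combine this with a topological fact.

Minimality gives the sets `F` by compactness. Each boundary point of `X_v` has an orbit meeting the
nonempty open set `∂Λ ∩ X_u`, hence lies in a basic open set given by such a `β`. Finitely many of
these cover the compact set `∂Λ ∩ X_v`, and the corresponding paths are exhaustive because every
path lies in a maximal directed set, which defines a boundary point.

Conversely, let an open set meet `∂Λ`. It contains the point of a maximal directed set `C`, and even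
every point containing `γΛ` for some `γ ∈ C`, since tail sets of elements of `C` form a base there
(`exists_tail_subset_of_mem_maximalPoint`). A boundary point `x` contains a tail set from every
finite exhaustive set (`exists_tail_mem_of_mem_FE`). If `x = αz` and `δ` runs from `s(α)` to `s(γ)`,
then `γδz` lies in the orbit and in the open set, and in `∂Λ` by invariance
(`act_mem_boundary_iff`).

Both facts rest on `mem_of_forall_meets`: a path outside a maximal directed set fails to meet some
element of it. Finite alignment makes zigzag domains finite unions of tail sets, so this separation
suffices for all of `𝒜_v`. -/

open CategoryTheory

namespace PathCat

variable {Λ : Type u} [Category.{v} Λ]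

/-! ### Directed sets of paths and the points of `X_v` -/

section Directed

/-- A filter on `vΛ` yields, by restriction of an ultrafilter refining it, a point of `X_v`. -/
def ofUltrafilter {v : Λ} (f : Ultrafilter (PathsTo v)) : X v :=
  ⟨{E | E ∈ ring v ∧ E ∈ f}, by
    refine (isUltrafilterIn_iff (isSetRing_ring v)).2 ⟨⟨fun _ h => h.1, ?_, ?_, ?_, ?_⟩, ?_⟩
    · exact ⟨Set.univ, univ_mem_ring v, Filter.univ_mem⟩
    · rintro E ⟨-, h⟩
      exact f.nonempty_of_mem h
    · rintro E ⟨h1, h2⟩ F ⟨h3, h4⟩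
      exact ⟨(isSetRing_ring v).inter_mem h1 h3, Filter.inter_mem h2 h4⟩
    · rintro E ⟨-, h⟩ F hF hEF
      exact ⟨hF, Filter.mem_of_superset h hEF⟩
    · intro E hE
      rcases f.mem_or_compl_mem E with h | h
      · exact Or.inl ⟨hE, h⟩
      · refine Or.inr ⟨Set.univ \ E, ⟨(isSetRing_ring v).sdiff_mem (univ_mem_ring v) hE, ?_⟩,
          by simp⟩
        rwa [← Set.compl_eq_univ_sdiff]⟩

theorem X.compl_mem {v : Λ} (x : X v) {E : Set (PathsTo v)} (hE : E ∈ ring v) (h : E ∉ x.1) :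
    Set.univ \ E ∈ x.1 := by
  rcases ((isUltrafilterIn_iff (isSetRing_ring v)).1 x.2).2 E hE with h' | ⟨F, hF, hEF⟩
  · exact absurd h' h
  · refine x.2.1.superset_mem F hF _ ((isSetRing_ring v).sdiff_mem (univ_mem_ring v) hE) ?_
    refine fun t ht => ⟨trivial, fun hE => ?_⟩
    exact (Set.eq_empty_iff_forall_notMem.1 hEF) t ⟨hE, ht⟩

theorem X.not_disjoint {v : Λ} (x : X v) {E F : Set (PathsTo v)} (hE : E ∈ x.1) (hF : F ∈ x.1) :
    (E ∩ F).Nonempty :=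
  x.2.1.nonempty_of_mem _ (x.2.1.inter_mem _ hE _ hF)

theorem X.univ_mem {v : Λ} (x : X v) : Set.univ ∈ x.1 := by
  obtain ⟨E, hE⟩ := x.2.1.nonempty
  exact x.2.1.superset_mem E hE _ (univ_mem_ring v) (Set.subset_univ E)

theorem mem_tail_trans {v : Λ} {α β γ : PathsTo v} (h : γ ∈ tail β) (h' : β ∈ tail α) :
    γ ∈ tail α :=
  tail_subset_tail h' h

theorem IsDirectedSet.exists_mem {v : Λ} {C : Set (PathsTo v)} (hC : IsDirectedSet C)
    {α β : PathsTo v} (hα : α ∈ C) (hβ : β ∈ C) : ∃ γ ∈ C, γ ∈ tail α ∧ γ ∈ tail β := by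
  obtain ⟨γ, ⟨h1, h2⟩, h3⟩ := hC α hα β hβ
  exact ⟨γ, h3, h1, h2⟩

/-- A nonempty directed set contains an upper bound of any finite family of its elements,
chosen through a family of properties which are inherited by extensions. -/
theorem IsDirectedSet.exists_forall {v : Λ} {C : Set (PathsTo v)} (hC : IsDirectedSet C)
    (hne : C.Nonempty) {ι : Type*} {G : Set ι} (hG : G.Finite) (p : ι → PathsTo v → Prop)
    (hp : ∀ i, ∀ α β, β ∈ tail α → p i α → p i β) (h : ∀ i ∈ G, ∃ γ ∈ C, p i γ) :
    ∃ γ ∈ C, ∀ i ∈ G, p i γ := by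
  induction G, hG using Set.Finite.induction_on with
  | empty => exact hne.imp fun γ hγ => ⟨hγ, by simp⟩
  | @insert a s ha hs ih =>
    obtain ⟨γ, hγ, h1⟩ := ih fun i hi => h i (Set.mem_insert_of_mem _ hi)
    obtain ⟨γ', hγ', h2⟩ := h a (Set.mem_insert _ _)
    obtain ⟨δ, hδ, h3, h4⟩ := hC.exists_mem hγ hγ'
    refine ⟨δ, hδ, ?_⟩
    rintro i (rfl | hi)
    · exact hp _ _ _ h4 h2
    · exact hp _ _ _ h3 (h1 i hi)

/-- Every directed set is contained in a maximal one. -/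
theorem IsDirectedSet.exists_maximal {v : Λ} {C : Set (PathsTo v)} (hC : IsDirectedSet C) :
    ∃ D ∈ maximalDirectedSets v, C ⊆ D := by
  have hchain : ∀ c ⊆ {D : Set (PathsTo v) | IsDirectedSet D}, IsChain (· ⊆ ·) c →
      IsDirectedSet (⋃₀ c) := by
    rintro c hc hchain α ⟨s, hs, hα⟩ β ⟨t, ht, hβ⟩
    rcases hchain.total hs ht with h | h
    · exact (hc ht α (h hα) β hβ).mono
        (Set.inter_subset_inter_right _ (Set.subset_sUnion_of_mem ht))
    · exact (hc hs α hα β (h hβ)).mono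
        (Set.inter_subset_inter_right _ (Set.subset_sUnion_of_mem hs))
  obtain ⟨D, hCD, hD⟩ := zorn_subset_nonempty {D : Set (PathsTo v) | IsDirectedSet D}
    (fun c hc h _ => ⟨⋃₀ c, hchain c hc h, fun _ => Set.subset_sUnion_of_mem⟩) C hC
  exact ⟨D, hD, hCD⟩

theorem exists_mem_maximalDirectedSets {v : Λ} (α : PathsTo v) :
    ∃ C ∈ maximalDirectedSets v, α ∈ C := by
  have h : IsDirectedSet ({α} : Set (PathsTo v)) := by
    rintro β rfl γ rfl
    exact ⟨_, ⟨mem_tail_self _, mem_tail_self _⟩, rfl⟩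
  obtain ⟨D, hD, h'⟩ := h.exists_maximal
  exact ⟨D, hD, h' rfl⟩

/-- The paths whose tail set belongs to the ultrafilter `x`. -/
def X.paths {v : Λ} (x : X v) : Set (PathsTo v) := {α | tail α ∈ x.1}

theorem X.mem_paths {v : Λ} {x : X v} {α : PathsTo v} : α ∈ x.paths ↔ tail α ∈ x.1 := Iff.rfl

/-- Finite alignment writes `αΛ ∩ βΛ` as a finite union of tail sets, and an ultrafilter containing
a finite union contains one of its members. -/
theorem X.isDirectedSet_paths [FinitelyAligned Λ] {v : Λ} (x : X v) : IsDirectedSet x.paths := by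
  intro α hα β hβ
  obtain ⟨G, hG, hGe⟩ := FinitelyAligned.exists_finite α β
  have h : (⋃ ε ∈ G, tail ε) ∈ x.1 := hGe ▸ x.2.1.inter_mem _ hα _ hβ
  obtain ⟨ε, hε, hm⟩ := x.2.exists_mem_of_biUnion (isSetRing_ring v) hG _
    (fun ε _ => tail_mem_ring ε) h
  refine ⟨ε, ?_, hm⟩
  rw [hGe]
  exact Set.mem_biUnion hε (mem_tail_self ε)

/-- A path that meets all elements of a maximal directed set belongs to it. -/
theorem mem_of_forall_meets [FinitelyAligned Λ] {v : Λ} {C : Set (PathsTo v)}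
    (hC : C ∈ maximalDirectedSets v) {ε : PathsTo v} (h : ∀ γ ∈ C, Meets γ ε) : ε ∈ C := by
  have hne := nonempty_of_mem_maximalDirectedSets hC
  have : Nonempty C := hne.to_subtype
  -- The sets `γΛ ∩ εΛ` with `γ ∈ C` are nonempty and downward directed, so they generate a proper
  -- filter. An ultrafilter refining it defines a point `y` whose directed set of paths contains
  -- both `C` and `ε`; maximality of `C` then gives `ε ∈ C`.
  let f : Filter (PathsTo v) := ⨅ γ : C, Filter.principal (tail γ.1 ∩ tail ε)
  have hdir : Directed (· ≥ ·) fun γ : C => Filter.principal (tail γ.1 ∩ tail ε) := by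
    rintro ⟨α, hα⟩ ⟨β, hβ⟩
    obtain ⟨γ, hγ, h1, h2⟩ := hC.1.exists_mem hα hβ
    exact ⟨⟨γ, hγ⟩, Filter.principal_mono.2 (Set.inter_subset_inter_left _ (tail_subset_tail h1)),
      Filter.principal_mono.2 (Set.inter_subset_inter_left _ (tail_subset_tail h2))⟩
  have hf : f.NeBot := Filter.iInf_neBot_of_directed' hdir
    fun γ => Filter.principal_neBot_iff.2 (h γ.1 γ.2)
  let y := ofUltrafilter (Ultrafilter.of f)
  have hmem : ∀ γ ∈ C, tail γ ∩ tail ε ∈ Ultrafilter.of f := fun γ hγ =>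
    Ultrafilter.of_le f (Filter.mem_iInf_of_mem ⟨γ, hγ⟩ (Filter.mem_principal_self _))
  have hsub : C ⊆ y.paths := fun γ hγ =>
    ⟨tail_mem_ring γ, Filter.mem_of_superset (hmem γ hγ) Set.inter_subset_left⟩
  refine hC.2 y.isDirectedSet_paths hsub ?_
  obtain ⟨γ, hγ⟩ := hne
  exact ⟨tail_mem_ring ε, Filter.mem_of_superset (hmem γ hγ) Set.inter_subset_right⟩

theorem tail_mem_maximalPoint {v : Λ} {C : Set (PathsTo v)} (hC : C ∈ maximalDirectedSets v)
    {α : PathsTo v} (hα : α ∈ C) : tail α ∈ (maximalPoint C hC).1 :=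
  ⟨tail_mem_ring α, α, hα, Set.inter_subset_right⟩

theorem paths_maximalPoint [FinitelyAligned Λ] {v : Λ} {C : Set (PathsTo v)} (hC : C ∈ maximalDirectedSets v) :
    (maximalPoint C hC).paths = C :=
  have h : C ⊆ (maximalPoint C hC).paths := fun _ hα => tail_mem_maximalPoint hC hα
  Set.Subset.antisymm (hC.2 (X.isDirectedSet_paths _) h) h

theorem Meets.of_mem_tail {v : Λ} {α β ε : PathsTo v} (h : β ∈ tail α) (h' : Meets β ε) :
    Meets α ε :=
  h'.mono (Set.inter_subset_inter_left _ (tail_subset_tail h))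

theorem X.mem_paths_of_mem_tail {v : Λ} {x : X v} {α β : PathsTo v} (h : β ∈ tail α)
    (hβ : β ∈ x.paths) : α ∈ x.paths :=
  x.2.1.superset_mem _ hβ _ (tail_mem_ring α) (tail_subset_tail h)

/-- An element of a directed set that contains `α` has an extension of the form `αδ` in it. -/
theorem IsDirectedSet.exists_concat_mem {w v : Λ} {α : w ⟶ v} {C : Set (PathsTo v)}
    (hC : IsDirectedSet C) (hα : (⟨w, α⟩ : PathsTo v) ∈ C) {β : PathsTo v} (hβ : β ∈ C) :
    ∃ δ, concat α δ ∈ C ∧ concat α δ ∈ tail β := by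
  obtain ⟨_, hγ, ⟨δ, rfl⟩, h⟩ := hC.exists_mem hα hβ
  exact ⟨δ, hγ, h⟩

theorem maximalPoint_mem_boundary {v : Λ} {C : Set (PathsTo v)}
    (hC : C ∈ maximalDirectedSets v) : (⟨v, maximalPoint C hC⟩ : UnitSpace Λ) ∈ boundary Λ :=
  subset_closure ⟨v, C, hC, rfl⟩

end Directed

/-! ### Finite alignment: zigzag domains are finite unions of tail sets -/

section FiniteUnions

/-- A finite union of tail sets. -/
def IsFiniteUnionOfTails {v : Λ} (E : Set (PathsTo v)) : Prop :=
  ∃ G : Set (PathsTo v), G.Finite ∧ E = ⋃ ε ∈ G, tail ε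

theorem IsFiniteUnionOfTails.biUnion {v : Λ} {ι : Type*} {G : Set ι} (hG : G.Finite)
    {f : ι → Set (PathsTo v)} (h : ∀ i ∈ G, IsFiniteUnionOfTails (f i)) :
    IsFiniteUnionOfTails (⋃ i ∈ G, f i) := by
  choose! H hH hf using h
  refine ⟨⋃ i ∈ G, H i, hG.biUnion hH, ?_⟩
  rw [Set.biUnion_iUnion]
  refine Set.iUnion_congr fun i => ?_
  rw [Set.biUnion_iUnion]
  exact Set.iUnion_congr fun hi => hf i hi

theorem IsFiniteUnionOfTails.image {w v : Λ} (α : w ⟶ v) {E : Set (PathsTo w)}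
    (h : IsFiniteUnionOfTails E) : IsFiniteUnionOfTails (concat α '' E) := by
  obtain ⟨G, hG, rfl⟩ := h
  rw [Set.image_iUnion₂]
  refine .biUnion hG fun ε _ => ⟨{concat α ε}, Set.finite_singleton _, ?_⟩
  rw [Set.biUnion_singleton, tail, tail, ← Set.range_comp]
  congr 1
  ext1 γ
  exact (concat_comp _ _ _).symm

theorem concat_preimage_tail_concat [CategoryOfPaths Λ] {w v : Λ} (β : w ⟶ v) (δ : PathsTo w) :
    concat β ⁻¹' tail (concat β δ) = tail δ := by
  have h : tail (concat β δ) = concat β '' tail δ := by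
    rw [tail, tail, ← Set.range_comp]
    congr 1
    ext1 γ
    exact concat_comp _ _ _
  rw [h, Set.preimage_image_eq _ (concat_injective β)]

variable [FinitelyAligned Λ]

theorem isFiniteUnionOfTails_preimage_tail [CategoryOfPaths Λ] {w v : Λ} (β : w ⟶ v)
    (α : PathsTo v) : IsFiniteUnionOfTails (concat β ⁻¹' tail α) := by
  obtain ⟨G, hG, hGe⟩ := FinitelyAligned.exists_finite α (⟨w, β⟩ : PathsTo v)
  have hpre : concat β ⁻¹' tail α = ⋃ ε ∈ G, concat β ⁻¹' tail ε := by
    rw [← Set.preimage_iUnion₂, ← hGe, Set.preimage_inter]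
    exact (Set.inter_eq_left.2 fun γ _ => show concat β γ ∈ tail _ from ⟨γ, rfl⟩).symm
  rw [hpre]
  refine .biUnion hG fun ε hε => ?_
  have h : ε ∈ tail α ∩ tail (⟨w, β⟩ : PathsTo v) := by
    rw [hGe]; exact Set.mem_biUnion hε (mem_tail_self ε)
  -- Each `ε` in the finite union extends `β`, say `ε = βδ`, and by left cancellation the preimage
  -- of its tail set is `δΛ`.
  obtain ⟨-, δ, rfl⟩ := h
  exact ⟨{δ}, Set.finite_singleton δ, by simp [concat_preimage_tail_concat]⟩

theorem IsFiniteUnionOfTails.preimage [CategoryOfPaths Λ] {w v : Λ} (β : w ⟶ v)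
    {E : Set (PathsTo v)} (h : IsFiniteUnionOfTails E) :
    IsFiniteUnionOfTails (concat β ⁻¹' E) := by
  obtain ⟨G, hG, rfl⟩ := h
  rw [Set.preimage_iUnion₂]
  exact .biUnion hG fun ε _ => isFiniteUnionOfTails_preimage_tail β ε

/-- Appending `(α, β)` to `ζ` replaces the domain `A(ζ)` by the preimage under `β` of `αA(ζ)`, and
both operations preserve finite unions of tail sets. -/
theorem Zigzag.isFiniteUnionOfTails_domain [CategoryOfPaths Λ] {w v : Λ} (ζ : Zigzag w v) :
    IsFiniteUnionOfTails ζ.domain := by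
  induction ζ with
  | single α β =>
    convert isFiniteUnionOfTails_preimage_tail β ⟨_, α⟩
    ext γ
    simp [Zigzag.domain, Zigzag.Graph, tail]
  | snoc ζ α β ih =>
    convert (ih.image α).preimage β
    ext γ
    simp only [Zigzag.domain, Zigzag.Graph, Set.mem_ofPred_eq, Set.mem_preimage, Set.mem_image]
    exact ⟨fun ⟨δ, ε, h1, h2⟩ => ⟨ε, ⟨δ, h2⟩, h1⟩, fun ⟨ε, ⟨δ, h2⟩, h1⟩ => ⟨δ, ε, h1, h2⟩⟩

end FiniteUnions

/-! ### Neighbourhood bases at maximal points, and translation by a path -/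

section MaximalPoints

variable [CategoryOfPaths Λ]

theorem concat_mem_paths_act {w v : Λ} (α : w ⟶ v) (z : X w) {δ : PathsTo w} :
    concat α δ ∈ (act α z).paths ↔ δ ∈ z.paths := by
  rw [X.mem_paths, mem_act, concat_preimage_tail_concat, X.mem_paths]
  exact and_iff_right (tail_mem_ring _)

theorem isDirectedSet_preimage_concat {w v : Λ} (α : w ⟶ v) {C : Set (PathsTo v)}
    (hC : IsDirectedSet C) : IsDirectedSet (concat α ⁻¹' C) := by
  intro δ hδ δ' hδ'
  obtain ⟨γ, hγ, h1, h2⟩ := hC.exists_mem hδ hδ'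
  have h3 : γ ∈ tail (⟨w, α⟩ : PathsTo v) := mem_tail_trans h1 ⟨δ, rfl⟩
  obtain ⟨η, rfl⟩ := h3
  rw [← Set.mem_preimage, concat_preimage_tail_concat] at h1 h2
  exact ⟨η, ⟨h1, h2⟩, hγ⟩

/-- This carries a directed set in `s(α)Λ` to one in `r(α)Λ` that is closed under initial segments;
it transports maximality along `α`. -/
theorem isDirectedSet_prefixes {w v : Λ} (α : w ⟶ v) {D : Set (PathsTo w)}
    (hD : IsDirectedSet D) : IsDirectedSet {β : PathsTo v | ∃ δ ∈ D, concat α δ ∈ tail β} := by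
  rintro β ⟨δ, hδ, h⟩ β' ⟨δ', hδ', h'⟩
  obtain ⟨η, hη, h1, h2⟩ := hD.exists_mem hδ hδ'
  rw [← concat_preimage_tail_concat α] at h1 h2
  exact ⟨concat α η, ⟨mem_tail_trans h1 h, mem_tail_trans h2 h'⟩, η, hη, mem_tail_self _⟩

variable [FinitelyAligned Λ]

/-- Stronger than what defines `directedFilter`: the whole of `γΛ`, not only `C ∩ γΛ`, is on one
side of `E`. This is where maximality of `C` enters. -/
theorem exists_tail_subset_or_compl {v : Λ} {C : Set (PathsTo v)}
    (hC : C ∈ maximalDirectedSets v) {E : Set (PathsTo v)} (hE : E ∈ ring v) :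
    (∃ γ ∈ C, tail γ ⊆ E) ∨ ∃ γ ∈ C, tail γ ⊆ Eᶜ := by
  have hne := nonempty_of_mem_maximalDirectedSets hC
  refine ring_induction (p := fun E => (∃ γ ∈ C, tail γ ⊆ E) ∨ ∃ γ ∈ C, tail γ ⊆ Eᶜ)
    ?_ ?_ ?_ ?_ hE
  · obtain ⟨γ, hγ⟩ := hne
    exact Or.inr ⟨γ, hγ, by simp⟩
  · intro w ζ
    by_cases h : ∃ γ ∈ C, γ ∈ ζ.domain
    · obtain ⟨γ, hγ, h⟩ := h
      exact Or.inl ⟨γ, hγ, ζ.tail_subset_domain h⟩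
    · push Not at h
      -- No `ε ∈ G` is in `C`, so each fails to meet some element of `C`. A common extension in `C`
      -- of these finitely many elements misses the whole domain.
      obtain ⟨G, hG, hGe⟩ := ζ.isFiniteUnionOfTails_domain
      obtain ⟨γ, hγ, h'⟩ := hC.1.exists_forall hne hG (fun ε γ => ¬ Meets γ ε)
        (fun ε α β hβ h1 h2 => h1 (h2.of_mem_tail hβ)) (fun ε hε => by
          by_contra hcon
          push Not at hcon
          refine h ε (mem_of_forall_meets hC hcon) ?_
          rw [hGe]
          exact Set.mem_biUnion hε (mem_tail_self ε))
      refine Or.inr ⟨γ, hγ, fun t ht h1 => ?_⟩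
      rw [hGe] at h1
      obtain ⟨ε, hε, h1⟩ := Set.mem_iUnion₂.1 h1
      exact h' ε hε ⟨t, ht, h1⟩
  · rintro E F (⟨α, hα, h⟩ | ⟨α, hα, h⟩) hF
    · exact Or.inl ⟨α, hα, h.trans Set.subset_union_left⟩
    · rcases hF with ⟨β, hβ, h'⟩ | ⟨β, hβ, h'⟩
      · exact Or.inl ⟨β, hβ, h'.trans Set.subset_union_right⟩
      · obtain ⟨γ, hγ, h1, h2⟩ := hC.1.exists_mem hα hβ
        refine Or.inr ⟨γ, hγ, ?_⟩
        rw [Set.compl_union]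
        exact Set.subset_inter ((tail_subset_tail h1).trans h) ((tail_subset_tail h2).trans h')
  · rintro E F (⟨α, hα, h⟩ | ⟨α, hα, h⟩) hF
    · rcases hF with ⟨β, hβ, h'⟩ | ⟨β, hβ, h'⟩
      · exact Or.inr ⟨β, hβ, fun t ht h1 => h1.2 (h' ht)⟩
      · obtain ⟨γ, hγ, h1, h2⟩ := hC.1.exists_mem hα hβ
        exact Or.inl ⟨γ, hγ,
          fun t ht => ⟨h (tail_subset_tail h1 ht), h' (tail_subset_tail h2 ht)⟩⟩
    · exact Or.inr ⟨α, hα, fun t ht h1 => h ht h1.1⟩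

theorem exists_tail_subset_of_mem_maximalPoint {v : Λ} {C : Set (PathsTo v)}
    (hC : C ∈ maximalDirectedSets v) {E : Set (PathsTo v)} (hE : E ∈ (maximalPoint C hC).1) :
    ∃ γ ∈ C, tail γ ⊆ E := by
  rcases exists_tail_subset_or_compl hC hE.1 with h | ⟨γ, hγ, h⟩
  · exact h
  · obtain ⟨-, α, hα, h'⟩ := hE
    obtain ⟨δ, hδ, h1, h2⟩ := hC.1.exists_mem hα hγ
    exact absurd (h' ⟨hδ, h1⟩) (h h2)

/-- Together with `paths_maximalPoint`, this identifies the points of maximal directed sets with the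
`x` for which `x.paths` is maximal, a condition easier to move along a path. -/
theorem eq_maximalPoint {v : Λ} (x : X v) (hx : x.paths ∈ maximalDirectedSets v) :
    x = maximalPoint x.paths hx := by
  refine (Subtype.ext ((maximalPoint x.paths hx).2.eq_of_subset x.2 fun E hE => ?_)).symm
  obtain ⟨γ, hγ, h⟩ := exists_tail_subset_of_mem_maximalPoint hx hE
  exact x.2.1.superset_mem _ hγ _ hE.1 h

theorem paths_act_mem_maximalDirectedSets {w v : Λ} (α : w ⟶ v) (z : X w) :
    (act α z).paths ∈ maximalDirectedSets v ↔ z.paths ∈ maximalDirectedSets w := by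
  have hα : (⟨w, α⟩ : PathsTo v) ∈ (act α z).paths := tail_mem_act α z
  constructor
  · refine fun h => ⟨z.isDirectedSet_paths, fun D hD hle δ hδ => ?_⟩
    refine (concat_mem_paths_act α z).1
      -- The initial segments of `αD` form a directed set containing the paths of `αz`, so by
      -- maximality nothing new is gained.
      (h.2 (isDirectedSet_prefixes α hD) (fun β hβ => ?_) ⟨δ, hδ, mem_tail_self _⟩)
    obtain ⟨η, h1, h2⟩ := h.1.exists_concat_mem hα hβ
    exact ⟨η, hle ((concat_mem_paths_act α z).1 h1), h2⟩
  · refine fun h => ⟨X.isDirectedSet_paths _, fun C hC hle β hβ => ?_⟩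
    obtain ⟨δ, h1, h2⟩ := hC.exists_concat_mem (hle hα) hβ
    -- The preimage of `C` under `α` is directed and contains `z.paths`, so it cannot be larger; `β`
    -- is an initial segment of `αδ`.
    have hδ : δ ∈ z.paths := h.2 (isDirectedSet_preimage_concat α hC)
      (fun η hη => hle ((concat_mem_paths_act α z).2 hη)) h1
    exact X.mem_paths_of_mem_tail h2 ((concat_mem_paths_act α z).2 hδ)

end MaximalPoints

/-! ### Compactness of `X_v`, and the boundary -/

section Topology

theorem X.isOpen_setOf_mem {v : Λ} {E : Set (PathsTo v)} (hE : E ∈ ring v) :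
    IsOpen {x : X v | E ∈ x.1} :=
  TopologicalSpace.isOpen_generateFrom_of_mem ⟨E, hE, rfl⟩

theorem X.exists_subset_of_isOpen {v : Λ} {U : Set (X v)} (hU : IsOpen U) {x : X v}
    (hx : x ∈ U) : ∃ E ∈ x.1, {y : X v | E ∈ y.1} ⊆ U := by
  induction hU with
  | basic s hs =>
    obtain ⟨E, -, rfl⟩ := hs
    exact ⟨E, hx, subset_rfl⟩
  | univ => exact ⟨Set.univ, x.univ_mem, Set.subset_univ _⟩
  | inter s t _ _ ihs iht =>
    obtain ⟨E, hE, h⟩ := ihs hx.1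
    obtain ⟨F, hF, h'⟩ := iht hx.2
    refine ⟨E ∩ F, x.2.1.inter_mem _ hE _ hF, fun y hy => ⟨h ?_, h' ?_⟩⟩
    · exact y.2.1.superset_mem _ hy _ (x.2.1.subset hE) Set.inter_subset_left
    · exact y.2.1.superset_mem _ hy _ (x.2.1.subset hF) Set.inter_subset_right
  | sUnion S _ ih =>
    obtain ⟨s, hs, hxs⟩ := hx
    obtain ⟨E, hE, h⟩ := ih s hs hxs
    exact ⟨E, hE, h.trans (Set.subset_sUnion_of_mem hs)⟩

instance (v : Λ) : CompactSpace (X v) := by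
  refine ⟨isCompact_iff_ultrafilter_le_nhds.2 fun f _ => ?_⟩
  -- The limit of `f` consists of the `E` whose basic open set belongs to `f`. That `vΛ` itself lies
  -- in `𝒜_v` makes this collection nonempty.
  have key : IsUltrafilterIn (ring v) {E | E ∈ ring v ∧ {x : X v | E ∈ x.1} ∈ f} := by
    refine (isUltrafilterIn_iff (isSetRing_ring v)).2 ⟨⟨fun _ h => h.1, ?_, ?_, ?_, ?_⟩, ?_⟩
    · exact ⟨Set.univ, univ_mem_ring v, Filter.univ_mem' fun x => x.univ_mem⟩
    · rintro E ⟨-, h⟩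
      obtain ⟨x, hx⟩ := f.nonempty_of_mem h
      exact x.2.1.nonempty_of_mem _ hx
    · rintro E ⟨h1, h2⟩ F ⟨h3, h4⟩
      refine ⟨(isSetRing_ring v).inter_mem h1 h3, ?_⟩
      filter_upwards [h2, h4] with x hE hF using x.2.1.inter_mem _ hE _ hF
    · rintro E ⟨-, h⟩ F hF hEF
      refine ⟨hF, ?_⟩
      filter_upwards [h] with x hE using x.2.1.superset_mem _ hE _ hF hEF
    · intro E hE
      rcases f.mem_or_compl_mem {x : X v | E ∈ x.1} with h | h
      · exact Or.inl ⟨hE, h⟩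
      · refine Or.inr ⟨Set.univ \ E, ⟨(isSetRing_ring v).sdiff_mem (univ_mem_ring v) hE, ?_⟩,
          by simp⟩
        filter_upwards [h] with x hx using x.compl_mem hE hx
  refine ⟨⟨_, key⟩, trivial, fun U hU => ?_⟩
  obtain ⟨V, hVU, hV, hx⟩ := mem_nhds_iff.1 hU
  obtain ⟨E, hE, h⟩ := X.exists_subset_of_isOpen hV hx
  exact Filter.mem_of_superset hE.2 (h.trans hVU)

theorem isOpen_preimage_mk {U : Set (UnitSpace Λ)} (hU : IsOpen U) (v : Λ) :
    IsOpen {x : X v | (⟨v, x⟩ : UnitSpace Λ) ∈ U} :=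
  isOpen_sigma_iff.1 hU v

theorem isOpen_image_mk {v : Λ} {U : Set (X v)} (hU : IsOpen U) :
    IsOpen ((fun x => (⟨v, x⟩ : UnitSpace Λ)) '' U) :=
  isOpenMap_sigmaMk (σ := X) U hU

variable [CategoryOfPaths Λ] [FinitelyAligned Λ]

theorem mem_boundary_iff {v : Λ} {x : X v} :
    (⟨v, x⟩ : UnitSpace Λ) ∈ boundary Λ ↔
      ∀ E ∈ x.1, ∃ y : X v, y.paths ∈ maximalDirectedSets v ∧ E ∈ y.1 := by
  constructor
  · intro hx E hE
    obtain ⟨_, ⟨y, hy, rfl⟩, w, C, hC, h⟩ := mem_closure_iff.1 hx _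
      (isOpen_image_mk (X.isOpen_setOf_mem (x.2.1.subset hE))) ⟨x, hE, rfl⟩
    obtain ⟨rfl, h⟩ := Sigma.mk.inj h
    obtain rfl := eq_of_heq h
    exact ⟨_, (paths_maximalPoint hC).symm ▸ hC, hy⟩
  · intro h
    refine mem_closure_iff.2 fun U hU hx => ?_
    obtain ⟨E, hE, hEU⟩ := X.exists_subset_of_isOpen (isOpen_preimage_mk hU v) hx
    obtain ⟨y, hy, hEy⟩ := h E hE
    exact ⟨⟨v, y⟩, hEU hEy, v, y.paths, hy, by rw [← eq_maximalPoint y hy]⟩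

/-- The boundary is invariant. -/
theorem act_mem_boundary_iff {w v : Λ} (α : w ⟶ v) {z : X w} :
    (⟨v, act α z⟩ : UnitSpace Λ) ∈ boundary Λ ↔ (⟨w, z⟩ : UnitSpace Λ) ∈ boundary Λ := by
  rw [mem_boundary_iff, mem_boundary_iff]
  constructor
  · intro h E hE
    obtain ⟨y, hy, hEy⟩ := h (concat α '' E)
      ⟨image_concat_mem_ring α (z.2.1.subset hE), E, hE, subset_rfl⟩
    -- A point containing `αE` contains `αΛ`, hence has the form `αt`.
    obtain ⟨t, rfl⟩ := exists_act_eq α y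
      (y.2.1.superset_mem _ hEy _ (tail_mem_ring _) (Set.image_subset_range _ _))
    rw [mem_act, Set.preimage_image_eq _ (concat_injective α)] at hEy
    exact ⟨t, (paths_act_mem_maximalDirectedSets α t).1 hy, hEy.2⟩
  · intro h E hE
    obtain ⟨hE, hE'⟩ := (mem_act α z).1 hE
    obtain ⟨y, hy, hEy⟩ := h _ hE'
    exact ⟨act α y, (paths_act_mem_maximalDirectedSets α y).2 hy, (mem_act α y).2 ⟨hE, hEy⟩⟩

/-- A boundary point lies in the tail set of some member of any finite exhaustive set. -/
theorem exists_tail_mem_of_mem_FE {v : Λ} {x : X v}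
    (hx : (⟨v, x⟩ : UnitSpace Λ) ∈ boundary Λ) {F : Set (PathsTo v)} (hF : F ∈ FE v) :
    ∃ α ∈ F, tail α ∈ x.1 := by
  have hring : (⋃ α ∈ F, tail α) ∈ ring v := by
    simpa using (isSetRing_ring v).biUnion_mem hF.1.toFinset (s := tail)
      (fun α _ => tail_mem_ring α)
  refine x.2.exists_mem_of_biUnion (isSetRing_ring v) hF.1 _ (fun α _ => tail_mem_ring α) ?_
  -- Otherwise the complement of the union lies in `x`, hence in some `y` with maximal directed set
  -- of paths. No `ε ∈ F` is then a path of `y`, so each misses some path of `y`; a common extension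
  -- `γ` of these meets nothing in `F`, against exhaustiveness.
  by_contra hcon
  obtain ⟨y, hy, hy'⟩ := mem_boundary_iff.1 hx _ (x.compl_mem hring hcon)
  obtain ⟨γ, hγ, hγF⟩ := hy.1.exists_forall (nonempty_of_mem_maximalDirectedSets hy) hF.1
    (fun ε γ => ¬ Meets γ ε) (fun ε α β hβ h1 h2 => h1 (h2.of_mem_tail hβ)) (fun ε hε => by
      by_contra hc
      push Not at hc
      obtain ⟨t, ht, ht'⟩ := y.not_disjoint (mem_of_forall_meets hy hc) hy'
      exact ht'.2 (Set.mem_biUnion hε ht))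
  obtain ⟨β, hβ, h⟩ := hF.2 γ
  exact hγF β hβ h

end Topology

/-! ### The two implications -/

section Minimality

variable [CategoryOfPaths Λ] [FinitelyAligned Λ]

theorem exists_exhaustive_of_isMinimalGroupoid (h : IsMinimalGroupoid (boundary Λ)) (u v : Λ) :
    ∃ F ∈ FE v, ∀ α ∈ F, Nonempty (α.1 ⟶ u) := by
  have cover : ∀ x : X v, (⟨v, x⟩ : UnitSpace Λ) ∈ boundary Λ →
      ∃ β : PathsTo v, Nonempty (β.1 ⟶ u) ∧ tail β ∈ x.1 := by
    intro x hx
    -- Only needed to see that `∂Λ ∩ X_u` is nonempty, so that a dense orbit must meet it.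
    obtain ⟨C, hC, -⟩ := exists_mem_maximalDirectedSets (⟨u, 𝟙 u⟩ : PathsTo u)
    obtain ⟨⟨_, hy⟩, ⟨y, -, rfl⟩, ⟨g⟩⟩ := (h ⟨⟨v, x⟩, hx⟩).inter_open_nonempty
      (Subtype.val ⁻¹' ((fun x : X u => (⟨u, x⟩ : UnitSpace Λ)) '' Set.univ))
      ((isOpen_image_mk isOpen_univ).preimage continuous_subtype_val)
      ⟨⟨_, maximalPoint_mem_boundary hC⟩, maximalPoint C hC, trivial, rfl⟩
    obtain ⟨p, -⟩ := Quotient.exists_rep (s := Triple.setoid (⟨v, x⟩ : UnitSpace Λ) ⟨u, y⟩) g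
    refine ⟨⟨p.v, p.β⟩, ⟨p.α⟩, ?_⟩
    have := tail_mem_act p.β p.z
    rwa [p.source_eq] at this
  have hclosed : IsClosed {x : X v | (⟨v, x⟩ : UnitSpace Λ) ∈ boundary Λ} :=
    ⟨isOpen_preimage_mk (U := (boundary Λ)ᶜ) isClosed_closure.isOpen_compl v⟩
  obtain ⟨F, hF, hFfin, hFc⟩ := hclosed.isCompact.elim_finite_subcover_image
    (b := {β : PathsTo v | Nonempty (β.1 ⟶ u)}) (c := fun β => {x : X v | tail β ∈ x.1})
    (fun β _ => X.isOpen_setOf_mem (tail_mem_ring β)) (fun x hx => by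
      obtain ⟨β, hβ, hβx⟩ := cover x hx
      exact Set.mem_biUnion (show β ∈ {β : PathsTo v | Nonempty (β.1 ⟶ u)} from hβ) hβx)
  refine ⟨F, ⟨hFfin, fun α => ?_⟩, hF⟩
  obtain ⟨C, hC, hα⟩ := exists_mem_maximalDirectedSets α
  obtain ⟨β, hβ, hβC⟩ := Set.mem_iUnion₂.1 (hFc (maximalPoint_mem_boundary hC))
  exact ⟨β, hβ, (maximalPoint C hC).not_disjoint (tail_mem_maximalPoint hC hα) hβC⟩

theorem isMinimalGroupoid_of_exists_exhaustive
    (h : ∀ u v : Λ, ∃ F ∈ FE v, ∀ α ∈ F, Nonempty (α.1 ⟶ u)) :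
    IsMinimalGroupoid (boundary Λ) := by
  rintro ⟨⟨v, x⟩, hx⟩
  refine dense_iff_inter_open.2 ?_
  rintro _ ⟨V, hV, rfl⟩ ⟨⟨_, hy⟩, hyV⟩
  obtain ⟨_, hpV, u, C, hC, rfl⟩ := mem_closure_iff.1 hy V hV hyV
  obtain ⟨E, hE, hEV⟩ := X.exists_subset_of_isOpen (isOpen_preimage_mk hV u) hpV
  obtain ⟨⟨w, γ⟩, hγ, hγE⟩ := exists_tail_subset_of_mem_maximalPoint hC hE
  -- The hypothesis is applied to `w = s(γ)` rather than `u`, so that `δ` can be prolonged by `γ`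
  -- and the new point lands in `γΛ`.
  obtain ⟨F, hF, hFw⟩ := h w v
  obtain ⟨⟨t, α⟩, hα, hαx⟩ := exists_tail_mem_of_mem_FE hx hF
  obtain ⟨δ⟩ := hFw _ hα
  obtain ⟨z, rfl⟩ := exists_act_eq α x hαx
  refine ⟨⟨⟨u, act (δ ≫ γ) z⟩, (act_mem_boundary_iff _).2 ((act_mem_boundary_iff α).1 hx)⟩, ?_,
    ⟨(Quotient.mk (Triple.setoid (⟨v, act α z⟩ : UnitSpace Λ) ⟨u, act (δ ≫ γ) z⟩)
      ⟨t, δ ≫ γ, α, z, rfl, rfl⟩ : Arrow _ _)⟩⟩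
  refine hEV ?_
  rw [act_comp]
  exact (act γ _).2.1.superset_mem _ (tail_mem_act γ _) _ hE.1 hγE

end Minimality

end PathCat

theorem theoremt {Λ : Type u} [Category.{v} Λ] [PathCat.CategoryOfPaths Λ]
    [PathCat.FinitelyAligned Λ] [Countable Λ] [∀ a b : Λ, Countable (a ⟶ b)] :
    PathCat.IsMinimalGroupoid (PathCat.boundary Λ) ↔
      ∀ u v : Λ, ∃ F ∈ PathCat.FE v, ∀ α ∈ F, Nonempty (α.1 ⟶ u) :=
  ⟨PathCat.exists_exhaustive_of_isMinimalGroupoid, PathCat.isMinimalGroupoid_of_exists_exhaustive⟩
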